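/- Let $\tau>0$, let $C=C([-\tau,0],\mathbb C)$ carry the uniform norm, let $\mathcal L_0:C\to\mathbb C$ be a bounded linear functional, written $\mathcal L_0(\varphi)=\int_{-\tau}^0 d\eta(\theta)\varphi(\theta)$, and consider the scalar linear RFDE $\dot z(t)=\mathcal L_0(z_t)$. Let $A_0$ be the generator of its semiflow ($A_0\varphi=\dot\varphi$ for $\varphi\in C^1$ with $\dot\varphi(0)=\mathcal L_0\varphi$), let $\Lambda$ be a nonempty finite set of eigenvalues of $A_0$, and let $P$ be the generalized eigenspace of $A_0$ for $\Lambda$, $c=\dim P$. Let $P^*\subset C([0,\tau],\mathbb C)$ be the generalized eigenspace for $\Lambda$ of the formal adjoint ($\psi\mapsto-\dot\psi$ for $\psi\in C^1$ with $\dot\psi(0)=-\int_{-\tau}^0\psi(-\theta)\,d\eta(\theta)$), and let $(\psi,\varphi)=\psi(0)\varphi(0)-\int_{-\tau}^0\int_0^\theta\psi(\xi-\theta)\,d\eta(\theta)\,\varphi(\xi)\,d\xi$. Let $\Phi=(\varphi_1,\dots,\varphi_c)$ and $\Psi=\mathrm{col}(\psi_1,\dots,\psi_c)$ be bases of $P$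 and $P^*$ with $(\Psi,\Phi)=I_c$, chosen so that the $c\times c$ matrix $B$ with $\dot\Phi=\Phi B$ is in Jordan form, with distinct eigenvalues $\lambda_1,\dots,\lambda_r$ and with Jordan blocks for $\lambda_j$ of sizes $n_{j,1}\ge\dots\ge n_{j,k_j}\ge1$ (ones above the diagonal). Let $\mathcal W$ be the space of $c\times c$ matrices, partitioned like $B$, whose only entries not forced to be zero lie in blocks belonging to two Jordan blocks $(j,p),(j,q')$ of the same eigenvalue, in the last row and the first $\min(n_{j,p},n_{j,q'})$ columns of the block; let $\delta=\dim\mathcal W$ and let $\Omega_1,\dots,\Omega_\delta$ be a basis of $\mathcal W$. Let $q=\operatorname{rank}\Phi(0)$ and let $\tau_0,\dots,\tau_{c-q}\in[-\tau,0]$ be such that $\operatorname{rank}\,\mathrm{col}(\Phi(\tau_0),\dots,\Phi(\tau_{c-q}))=c$. Given $A^m_j\in\mathbb C$ ($1\le m\le\delta$, $0\le j\le c-q$), consider the family $$\mathcal L(\alpha)z=\mathcal L_0 z+\sum_{m=1}^{\delta}\alpha_m\sum_{j=0}^{c-q}A^m_j\,z(\tau_j),\qquad \alpha\in\mathbb C^\delta.$$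 Suppose that at least one of the following holds. (a) $\sum_{j}\Psi(0)A^m_j\Phi(\tau_j)=\mathcal E(\Omega_m)$ for $m=1,\dots,\delta$, where $\mathcal E$ is an injective linear map from $\mathcal W$ into the space of $c\times c$ matrices with columns in the range of $\Psi(0)$, and $\mathrm{Mat}_{c\times c}=\{BM-MB: M\in \mathrm{Mat}_{c\times c}\}\oplus\mathcal E(\mathcal W)$. (b) $\mathcal L(\alpha)$ is a $\Lambda$-versal unfolding of $\dot z(t)=\mathcal L_0(z_t)$. This means that $\mathcal B(\alpha)=B+\Psi(0)[\mathcal L(\alpha)-\mathcal L_0](\Phi+h(\alpha))$ is a versal unfolding of $B=\mathcal B(0)$. Here $h$, defined near $0$ and smooth in the $C^1$ norm, has values in $(Q\cap C^1)^c$, where $Q=\{\varphi\in C:(\Psi,\varphi)=0\}$; it satisfies $h(0)=0$ and, for all $\alpha$ near $0$, in $C\oplus X_0\mathbb C$ (where $X_0(0)=1$ and $X_0(\theta)=0$ for $\theta<0$), $$\dot h+X_0[\mathcal L_0h-\dot h(0)]+(X_0-\Phi\Psi(0))[\mathcal L(\alpha)-\mathcal L_0](\Phi+h)=h\,\mathcal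 B(\alpha).$$ Versal means that for every analytic matrix family $A(\beta)$, $\beta\in\mathbb C^s$, with $A(\beta_0)=B$, there are analytic $\phi$ and $C$ near $\beta_0$ with $\phi(\beta_0)=0$, $C(\beta_0)=I$, $C(\beta)$ invertible and $A(\beta)=C(\beta)\mathcal B(\phi(\beta))C(\beta)^{-1}$. Then $q=1$, $\delta=c$, and there is an invertible linear change of parameters $\alpha\mapsto\beta=(\beta_0,\dots,\beta_{c-1})$ from $\mathbb C^\delta$ onto $\mathbb C^{c}$ such that, for all $\alpha\in\mathbb C^\delta$ and $z\in C$, $$\mathcal L(\alpha)z=\mathcal L_0z+\sum_{j=0}^{c-1}\beta_j\,z(\tau_j).$$ -/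

import Mathlib

open Topology

noncomputable section

namespace RFDE

/-! ### Function spaces on compact intervals -/

/-- The value at `t` of a continuous function on `[a,b]` (only used for `t ∈ [a,b]`;
the value is `0` elsewhere). -/
def ev {a b : ℝ} (f : C(Set.Icc a b, ℂ)) (t : ℝ) : ℂ :=
  open Classical in if h : t ∈ Set.Icc a b then f ⟨t, h⟩ else 0

/-- The phase space `C_1 = C([-τ,0], ℂ)` with the uniform norm. -/
abbrev Phase (τ : ℝ) : Type := C(Set.Icc (-τ) (0 : ℝ), ℂ)

/-- The adjoint phase space `C_1^* = C([0,τ], ℂ)`. -/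
abbrev PhaseStar (τ : ℝ) : Type := C(Set.Icc (0 : ℝ) τ, ℂ)

/-- `f` is continuously differentiable on `[a,b]` (one-sidedly at the end points), with
derivative the continuous function `g`. -/
def IsDeriv {a b : ℝ} (f g : C(Set.Icc a b, ℂ)) : Prop :=
  ∀ t ∈ Set.Icc a b, HasDerivWithinAt (ev f) (ev g t) (Set.Icc a b) t

/-! ### The generator, its formal adjoint, and their generalized eigenspaces -/

/-- `IsGen L₀ φ ψ`: `φ` is in the domain of the infinitesimal generator `A₀` of the semiflow of
`ż(t) = L₀(z_t)`, and `A₀ φ = ψ`; that is, `φ ∈ C¹`, `φ'(0) = L₀ φ` and `ψ = φ'`. -/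
def IsGen {τ : ℝ} (L₀ : Phase τ →L[ℂ] ℂ) (φ ψ : Phase τ) : Prop :=
  IsDeriv φ ψ ∧ ev ψ 0 = L₀ φ

/-- The function `θ ↦ ψ(-θ)` on `[-τ,0]`, for `ψ` on `[0,τ]`. -/
def reflect {τ : ℝ} (ψ : PhaseStar τ) : Phase τ where
  toFun θ := ψ ⟨-θ.1, by linarith [θ.2.2], by linarith [θ.2.1]⟩
  continuous_toFun := by fun_prop

/-- `IsGenStar L₀ ψ χ`: `ψ` is in the domain of the formal adjoint `A₀^*` of `A₀` and
`A₀^* ψ = χ`; that is, `ψ ∈ C¹([0,τ])`, `χ = -ψ'` and `ψ'(0) = -∫ ψ(-θ) dη(θ)`, where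
`∫ dη(θ) φ(θ)` stands for `L₀ φ`. -/
def IsGenStar {τ : ℝ} (L₀ : Phase τ →L[ℂ] ℂ) (ψ χ : PhaseStar τ) : Prop :=
  IsDeriv ψ (-χ) ∧ ev χ 0 = L₀ (reflect ψ)

/-- `InKerPow R lam k φ`: `φ` lies in the domain of `(A - lam)^k` and `(A - lam)^k φ = 0`, where
`R` is the graph of the (unbounded) operator `A`. -/
def InKerPow {X : Type} [AddCommGroup X] [Module ℂ X] (R : X → X → Prop) (lam : ℂ) :
    ℕ → X → Prop
  | 0, φ => φ = 0
  | k + 1, φ => ∃ ψ, R φ ψ ∧ InKerPow R lam k (ψ - lam • φ)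

/-- `lam` is an eigenvalue of the operator with graph `R`. -/
def IsEigenvalue {X : Type} [AddCommGroup X] [Module ℂ X] (R : X → X → Prop) (lam : ℂ) : Prop :=
  ∃ φ, φ ≠ 0 ∧ R φ (lam • φ)

/-- The generalized eigenspace, for the set `Λ`, of the operator with graph `R`. -/
def genEigenspace {X : Type} [AddCommGroup X] [Module ℂ X] (R : X → X → Prop) (Λ : Set ℂ) :
    Submodule ℂ X :=
  Submodule.span ℂ {φ | ∃ lam ∈ Λ, ∃ k, InKerPow R lam k φ}

/-- The generalized eigenspace `P` of `A₀` for `Λ`. -/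
def P {τ : ℝ} (L₀ : Phase τ →L[ℂ] ℂ) (Λ : Set ℂ) : Submodule ℂ (Phase τ) :=
  genEigenspace (IsGen L₀) Λ

/-- The generalized eigenspace `P^*` of the formal adjoint `A₀^*` for `Λ`. -/
def PStar {τ : ℝ} (L₀ : Phase τ →L[ℂ] ℂ) (Λ : Set ℂ) : Submodule ℂ (PhaseStar τ) :=
  genEigenspace (IsGenStar L₀) Λ

/-! ### The bilinear form -/

theorem continuous_convInt {τ : ℝ} (ψ : PhaseStar τ) (φ : Phase τ) :
    Continuous fun θ : Set.Icc (-τ) (0 : ℝ) =>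
      ∫ ξ in (0 : ℝ)..θ.1, ev ψ (ξ - θ.1) * ev φ ξ := by
  by_cases hτ : 0 ≤ τ
  · have hτ' : -τ ≤ 0 := by linarith
    have key : ∀ θ : Set.Icc (-τ) (0 : ℝ),
        (∫ ξ in (0 : ℝ)..θ.1, ev ψ (ξ - θ.1) * ev φ ξ) =
          ∫ ξ in (0 : ℝ)..θ.1,
            Set.IccExtend hτ ψ (ξ - θ.1) * Set.IccExtend hτ' φ ξ := by
      intro θ
      refine intervalIntegral.integral_congr fun ξ hξ => ?_
      rw [Set.uIcc_of_ge θ.2.2] at hξ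
      have h1 : ξ - θ.1 ∈ Set.Icc (0 : ℝ) τ :=
        ⟨by linarith [hξ.1], by linarith [hξ.2, θ.2.1]⟩
      have h2 : ξ ∈ Set.Icc (-τ) (0 : ℝ) := ⟨by linarith [hξ.1, θ.2.1], hξ.2⟩
      simp only [ev, dif_pos h1, dif_pos h2, Set.IccExtend_of_mem _ _ h1,
        Set.IccExtend_of_mem _ _ h2]
    simp_rw [key]
    have c1 : Continuous (Set.IccExtend hτ ψ) := ψ.continuous.Icc_extend'
    have c2 : Continuous (Set.IccExtend hτ' φ) := φ.continuous.Icc_extend'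
    exact intervalIntegral.continuous_parametric_intervalIntegral_of_continuous
      (by fun_prop) (by fun_prop)
  · have : IsEmpty (Set.Icc (-τ) (0 : ℝ)) := ⟨fun θ => hτ (by linarith [θ.2.1, θ.2.2])⟩
    exact continuous_of_const fun x => (IsEmpty.false x).elim

/-- The function `θ ↦ ∫_0^θ ψ(ξ - θ) φ(ξ) dξ` on `[-τ,0]`. -/
def convInt {τ : ℝ} (ψ : PhaseStar τ) (φ : Phase τ) : Phase τ :=
  ⟨_, continuous_convInt ψ φ⟩

/-- The adjoint bilinear form
`(ψ,φ) = ψ(0) φ(0) - ∫_{-τ}^0 ∫_0^θ ψ(ξ - θ) dη(θ) φ(ξ) dξ`, where `∫ dη(θ) f(θ)` stands for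
`L₀ f` (all quantities are scalars). -/
def pairing {τ : ℝ} (L₀ : Phase τ →L[ℂ] ℂ) (ψ : PhaseStar τ) (φ : Phase τ) : ℂ :=
  ev ψ 0 * ev φ 0 - L₀ (convInt ψ φ)

/-! ### Jordan matrices and the space `W` -/

/-- The data of a matrix in Jordan block diagonal form: distinct eigenvalues
`lam 0, …, lam (r-1)`; for each `j`, the `k j ≥ 1` Jordan blocks for `lam j`, of sizes
`n ⟨j,0⟩ ≥ n ⟨j,1⟩ ≥ … ≥ 1`. -/
structure JordanData where
  r : ℕ
  lam : Fin r → ℂ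
  lam_injective : Function.Injective lam
  k : Fin r → ℕ
  k_pos : ∀ j, 0 < k j
  n : (Σ j : Fin r, Fin (k j)) → ℕ
  n_pos : ∀ b, 0 < n b
  n_antitone : ∀ j, Antitone fun l : Fin (k j) => n ⟨j, l⟩

namespace JordanData

/-- Row and column indices: a block and a position in that block. -/
abbrev Idx (J : JordanData) : Type := Σ b : (Σ j : Fin J.r, Fin (J.k j)), Fin (J.n b)

/-- The Jordan matrix: `lam j` on the diagonal and, in each block, `1` on the upper diagonal. -/
def matrix (J : JordanData) : Matrix J.Idx J.Idx ℂ := fun x y =>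
  if x = y then J.lam x.1.1
  else if x.1 = y.1 ∧ y.2.1 = x.2.1 + 1 then 1 else 0

/-- The subspace `W`: the only entries that are not forced to be `0` lie, within the blocks
`(j,p),(j,q)` belonging to one eigenvalue, at the bottom ends of the oblique segments, i.e. in the
last row of the block and in its first `min (n (j,p)) (n (j,q))` columns. -/
def W (J : JordanData) : Submodule ℂ (Matrix J.Idx J.Idx ℂ) where
  carrier := {M | ∀ x y : J.Idx,
    ¬ (x.1.1 = y.1.1 ∧ x.2.1 + 1 = J.n x.1 ∧ y.2.1 < min (J.n x.1) (J.n y.1)) → M x y = 0}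
  add_mem' := by
    intro M N hM hN x y h
    simp [hM x y h, hN x y h]
  zero_mem' := by
    intro x y _
    rfl
  smul_mem' := by
    intro a M hM x y h
    simp [hM x y h]

end JordanData

/-- The map `M ↦ [B,M] = BM - MB`. -/
def commMap {ι : Type} [Fintype ι] [DecidableEq ι] (B : Matrix ι ι ℂ) :
    Matrix ι ι ℂ →ₗ[ℂ] Matrix ι ι ℂ :=
  LinearMap.mulLeft ℂ B - LinearMap.mulRight ℂ B

/-- The space of all matrices whose columns are in the range of the `c × 1` matrix with column
`v`. -/
def colRange {ι : Type} (v : ι → ℂ) : Submodule ℂ (Matrix ι ι ℂ) where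
  carrier := {M | ∀ y, (fun x => M x y) ∈ Submodule.span ℂ {v}}
  add_mem' := fun hM hN y => Submodule.add_mem _ (hM y) (hN y)
  zero_mem' := fun _ => Submodule.zero_mem _
  smul_mem' := fun a _ hM y => Submodule.smul_mem _ a (hM y)

/-! ### Versal unfoldings of matrices -/

/-- `𝓑` is a `p`-parameter unfolding of `B` at `α₀`: an analytic family of matrices (near `α₀`)
with `𝓑 α₀ = B`. -/
def IsUnfolding {ι : Type} {p : ℕ} (B : Matrix ι ι ℂ)
    (𝓑 : (Fin p → ℂ) → Matrix ι ι ℂ) (α₀ : Fin p → ℂ) : Prop :=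
  (∀ x y, AnalyticAt ℂ (fun α => 𝓑 α x y) α₀) ∧ 𝓑 α₀ = B

/-- `𝓑` is a versal unfolding of `B` at `α₀`: each unfolding `A` of `B` at a point `β₀` of some
`ℂ^q` is, near `β₀`, of the form `A β = C β * 𝓑 (φ β) * (C β)⁻¹` with `φ` and `C` analytic,
`φ β₀ = α₀`, `C β₀ = 1` and `C β` invertible. -/
def IsVersal {ι : Type} [Fintype ι] [DecidableEq ι] {p : ℕ} (B : Matrix ι ι ℂ)
    (𝓑 : (Fin p → ℂ) → Matrix ι ι ℂ) (α₀ : Fin p → ℂ) : Prop :=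
  IsUnfolding B 𝓑 α₀ ∧
    ∀ (q : ℕ) (A : (Fin q → ℂ) → Matrix ι ι ℂ) (β₀ : Fin q → ℂ), IsUnfolding B A β₀ →
      ∃ (φ : (Fin q → ℂ) → (Fin p → ℂ)) (C : (Fin q → ℂ) → Matrix ι ι ℂ),
        AnalyticAt ℂ φ β₀ ∧ (∀ x y, AnalyticAt ℂ (fun β => C β x y) β₀) ∧
        φ β₀ = α₀ ∧ C β₀ = 1 ∧
        ∀ᶠ β in 𝓝 β₀, IsUnit (C β) ∧ A β = C β * 𝓑 (φ β) * (C β)⁻¹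

/-! ### Versal unfoldings of RFDEs -/

section LambdaVersal

variable {τ : ℝ} {ι : Type} [Fintype ι]

/-- The row vector `[L - L₀](Φ + h)`. -/
def perturb (L₀ L : Phase τ →L[ℂ] ℂ) (Φ h : ι → Phase τ) : ι → ℂ :=
  fun i => (L - L₀) (Φ i + h i)

/-- The matrix `B + Ψ(0)[L - L₀](Φ + h)`. -/
def reducedMatrix (L₀ L : Phase τ →L[ℂ] ℂ) (Φ : ι → Phase τ) (Ψ : ι → PhaseStar τ)
    (B : Matrix ι ι ℂ) (h : ι → Phase τ) : Matrix ι ι ℂ :=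
  B + Matrix.vecMulVec (fun i => ev (Ψ i) 0) (perturb L₀ L Φ h)

/-- The `i`-th component of
`N(h) = (A_{Q¹} + (I-π) X₀ [L-L₀]) h + (I-π) X₀ [L-L₀] Φ - h (B + Ψ(0) [L-L₀](Φ+h))`.
Here the argument after `h` is the derivative of `h`, an element `φ + X₀ μ` of `BC_1` is the pair `(φ, μ)`, and
`A_{Q¹} φ = φ' + X₀ (L₀ φ - φ'(0))`, `(I-π) X₀ μ = X₀ μ - Φ Ψ(0) μ`. -/
def residual (L₀ L : Phase τ →L[ℂ] ℂ) (Φ : ι → Phase τ) (Ψ : ι → PhaseStar τ)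
    (B : Matrix ι ι ℂ) (h h' : ι → Phase τ) (i : ι) : Phase τ × ℂ :=
  (h' i, L₀ (h i) - ev (h' i) 0)
    + (-∑ k, (ev (Ψ k) 0 * perturb L₀ L Φ h i) • Φ k, perturb L₀ L Φ h i)
    - (∑ k, reducedMatrix L₀ L Φ Ψ B h k i • h k, 0)

/-- The family `L(α)` of RFDEs is a `Λ`-versal unfolding of `ż(t) = L₀(z_t)`, where `Φ` and `Ψ`
are dual bases of `P` and `P^*` and `Φ' = Φ B`: for the smooth solution `h` with values in
`(Q¹)^c` (`Q = {φ | (Ψ,φ) = 0}`, `C¹` norm) of `N(α, h(α)) = 0`, `h(0) = 0`, for `α` near `0`, the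
matrix family `𝓑(α) = B + Ψ(0)[L(α) - L₀](Φ + h(α))` is a versal unfolding of `B`. Smoothness with
respect to the complex parameters is analyticity. -/
def IsLambdaVersal [DecidableEq ι] {p : ℕ} (L₀ : Phase τ →L[ℂ] ℂ) (Φ : ι → Phase τ)
    (Ψ : ι → PhaseStar τ) (B : Matrix ι ι ℂ) (L : (Fin p → ℂ) → Phase τ →L[ℂ] ℂ) : Prop :=
  AnalyticAt ℂ L 0 ∧ L 0 = L₀ ∧
    ∃ h h' : (Fin p → ℂ) → ι → Phase τ,
      AnalyticAt ℂ h 0 ∧ AnalyticAt ℂ h' 0 ∧ h 0 = 0 ∧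
      (∀ᶠ α in 𝓝 (0 : Fin p → ℂ), ∀ i,
        IsDeriv (h α i) (h' α i) ∧ (∀ k, pairing L₀ (Ψ k) (h α i) = 0) ∧
        residual L₀ (L α) Φ Ψ B (h α) (h' α) i = 0) ∧
      IsVersal B (fun α => reducedMatrix L₀ (L α) Φ Ψ B (h α)) 0

end LambdaVersal

/-- The operator `z ↦ Σ_j a_j z(t_j)`. -/
def delayOp {τ : ℝ} {N : ℕ} (t : Fin N → Set.Icc (-τ) (0 : ℝ)) (a : Fin N → ℂ) :
    Phase τ →L[ℂ] ℂ :=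
  ∑ j, a j • ContinuousMap.evalCLM ℂ (t j)

/-- The `δ`-parameter family `L(α) = L₀ + Σ_m α_m L_m` with `L_m(z) = Σ_j A^m_j z(t_j)`. -/
def delayFamily {τ : ℝ} {N δ : ℕ} (L₀ : Phase τ →L[ℂ] ℂ)
    (t : Fin N → Set.Icc (-τ) (0 : ℝ)) (A : Fin δ → Fin N → ℂ) (α : Fin δ → ℂ) :
    Phase τ →L[ℂ] ℂ :=
  L₀ + ∑ m, α m • delayOp t (A m)

/-- The coefficients `A^m_j` are obtained from a basis `Ω` of `W` by solving
`𝓔(Ω_m) = Σ_j Ψ(0) A^m_j Φ(t_j)`, where `𝓔` is an injective linear map from `W` into the space of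
matrices with columns in the range of `Ψ(0)`, whose range is a complement to the range of
`M ↦ [B,M]`. -/
def IsCanonicalChoice {τ : ℝ} {N δ : ℕ} (J : JordanData) (Φ : J.Idx → Phase τ)
    (Ψ : J.Idx → PhaseStar τ) (Ω : Module.Basis (Fin δ) ℂ J.W)
    (t : Fin N → Set.Icc (-τ) (0 : ℝ)) (A : Fin δ → Fin N → ℂ) : Prop :=
  ∃ 𝓔 : J.W →ₗ[ℂ] Matrix J.Idx J.Idx ℂ,
    Function.Injective 𝓔 ∧
    LinearMap.range 𝓔 ≤ colRange (fun i => ev (Ψ i) 0) ∧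
    IsCompl (LinearMap.range (commMap J.matrix)) (LinearMap.range 𝓔) ∧
    ∀ m, 𝓔 (Ω m) =
      ∑ j, A m j • Matrix.vecMulVec (fun i => ev (Ψ i) 0) (fun i => Φ i (t j))

end RFDE

end

namespace RFDE

/-! ### Eigenfunctions are exponentials -/

/-! For a scalar equation, `φ' = λφ` forces `φ(s) = φ(0) exp(λs)`, so an eigenfunction does not
vanish at `0` and each eigenvalue has a one-dimensional eigenspace. The first gives `rank Φ(0) = 1`;
the second gives one Jordan block per eigenvalue (`block_eq_of_eigenvalue_eq`), whence `dim W = c`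
(`finrank_W_of_block_injective`).

Since `L(α)` depends on `α` only through the coefficient vector `Σ_m α_m A^m`, the change of
parameters has to be `coeffMap A`. It goes between spaces of equal dimension `δ = c = c - q + 1`, so
injectivity suffices. Under (a), the injective map `α ↦ 𝓔(Σ α_m Ω_m)` factors through `coeffMap A`.
Under (b), versality makes the derivative of the reduced family transversal to the range of `M ↦
[B,M]` (`mem_range_sup_of_isLambdaVersal`). The centralizer of `B` has dimension at least `c`, so
this range has codimension at least `c`; a transversal linear map from a `c`-dimensional space is
then injective, and this derivative too factors through `coeffMap A`. -/

theorem ev_eq_exp_of_isDeriv {τ : ℝ} (hτ : 0 < τ) {φ : Phase τ} {lam : ℂ}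
    (h : IsDeriv φ (lam • φ)) {s : ℝ} (hs : s ∈ Set.Icc (-τ) (0 : ℝ)) :
    ev φ s = ev φ 0 * Complex.exp (lam * s) := by
  have h0 : (0 : ℝ) ∈ Set.Icc (-τ) (0 : ℝ) := ⟨by linarith, le_rfl⟩
  -- Integrating factor: `φ(u) exp(-λu)` has zero derivative, hence is constant.
  have hd : ∀ u ∈ Set.Icc (-τ) (0 : ℝ), HasDerivWithinAt
      (fun u : ℝ => ev φ u * Complex.exp (-(lam * u))) 0 (Set.Icc (-τ) 0) u := by
    intro u hu
    have h1 : HasDerivAt (fun u : ℝ => Complex.exp (-(lam * u)))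
        (Complex.exp (-(lam * u)) * (-(lam * 1))) u :=
      (((hasDerivAt_id u).ofReal_comp.const_mul lam).neg).cexp
    have h2 := (h u hu).mul h1.hasDerivWithinAt
    have hev : ev (lam • φ) u = lam * ev φ u := by simp [ev, hu.1, hu.2]
    rw [hev] at h2
    exact h2.congr_deriv (by ring)
  have hconst := (convex_Icc (-τ) (0 : ℝ)).norm_image_sub_le_of_norm_hasDerivWithin_le
    (C := 0) hd (by simp) h0 hs
  have hconst' : ev φ s * Complex.exp (-(lam * s)) = ev φ 0 := by
    simpa [sub_eq_zero] using hconst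
  rw [← hconst', mul_assoc, ← Complex.exp_add]
  simp

theorem eq_zero_of_isDeriv_of_ev_zero {τ : ℝ} (hτ : 0 < τ) {φ : Phase τ} {lam : ℂ}
    (h : IsDeriv φ (lam • φ)) (h0 : ev φ 0 = 0) : φ = 0 := by
  ext s
  have := ev_eq_exp_of_isDeriv hτ h s.2
  rw [h0, zero_mul] at this
  simpa [ev, s.2.1, s.2.2] using this

/-- Both functions are multiples of the same exponential; this is the one-dimensionality of
eigenspaces, in a form without division. -/
theorem smul_eq_smul_of_isDeriv {τ : ℝ} (hτ : 0 < τ) {φ χ : Phase τ} {lam : ℂ}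
    (hφ : IsDeriv φ (lam • φ)) (hχ : IsDeriv χ (lam • χ)) :
    ev χ 0 • φ = ev φ 0 • χ := by
  ext s
  have h1 := ev_eq_exp_of_isDeriv hτ hφ s.2
  have h2 := ev_eq_exp_of_isDeriv hτ hχ s.2
  have e1 : ev φ s = φ s := dif_pos s.2
  have e2 : ev χ s = χ s := dif_pos s.2
  simp only [ContinuousMap.smul_apply, smul_eq_mul, ← e1, ← e2, h1, h2]
  ring

/-! ### Jordan matrices with one block for each eigenvalue -/

namespace JordanData

variable (J : JordanData)

/-- The first index of a block. -/
def first (b : Σ j : Fin J.r, Fin (J.k j)) : J.Idx := ⟨b, ⟨0, J.n_pos b⟩⟩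

/-- The last index of a block. -/
def last (b : Σ j : Fin J.r, Fin (J.k j)) : J.Idx :=
  ⟨b, ⟨J.n b - 1, Nat.sub_lt (J.n_pos b) one_pos⟩⟩

theorem idx_ext {x y : J.Idx} (h1 : x.1 = y.1) (h2 : x.2.1 = y.2.1) : x = y := by
  obtain ⟨b, i⟩ := x
  obtain ⟨b', i'⟩ := y
  obtain rfl : b = b' := h1
  obtain rfl : i = i' := Fin.ext h2
  rfl

theorem matrix_first (b : Σ j : Fin J.r, Fin (J.k j)) (x : J.Idx) :
    J.matrix x (J.first b) = if x = J.first b then J.lam b.1 else 0 := by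
  unfold matrix
  split_ifs with h1 h2
  · rw [h1]; rfl
  · simp [first] at h2
  · rfl

/-- With a single block per eigenvalue, the free entries of `W` are the last rows of the diagonal
blocks: exactly one for each column. -/
theorem finrank_W_of_block_injective
    (hJ : ∀ b b' : Σ j : Fin J.r, Fin (J.k j), b.1 = b'.1 → b = b') :
    Module.finrank ℂ J.W = Fintype.card J.Idx := by
  let f : J.W →ₗ[ℂ] (J.Idx → ℂ) :=
    { toFun := fun M y => M.1 (J.last y.1) y
      map_add' := fun _ _ => rfl
      map_smul' := fun _ _ => rfl }
  have hf : Function.Bijective f := by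
    constructor
    · rw [injective_iff_map_eq_zero]
      intro M hM
      ext x y
      by_cases h : x.1.1 = y.1.1 ∧ x.2.1 + 1 = J.n x.1 ∧ y.2.1 < min (J.n x.1) (J.n y.1)
      · have hx : x = J.last y.1 := by
          refine J.idx_ext (hJ _ _ h.1) ?_
          have h1 := h.2.1
          have h2 := congrArg J.n (hJ _ _ h.1)
          change x.2.1 = J.n y.1 - 1
          omega
        rw [hx]
        exact congrFun hM y
      · exact M.2 x y h
    · intro g
      refine ⟨⟨fun x y => if x = J.last y.1 then g y else 0, ?_⟩, ?_⟩
      · intro x y h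
        refine if_neg fun hx => h ?_
        have := J.n_pos y.1
        rw [hx]
        exact ⟨rfl, Nat.sub_add_cancel this, by simp [last]⟩
      · funext y
        exact if_pos rfl
  rw [(LinearEquiv.ofBijective f hf).finrank_eq, Module.finrank_fintype_fun_eq_card]

/-- The `z.2`-th power of the nilpotent part of the block of `z`, extended by zero. -/
def shift (z : J.Idx) : Matrix J.Idx J.Idx ℂ := fun x y =>
  if x.1 = z.1 ∧ y.1 = z.1 ∧ y.2.1 = x.2.1 + z.2.1 then 1 else 0

/-- The nilpotent part of the Jordan matrix. -/
def nilpart : Matrix J.Idx J.Idx ℂ := fun x y =>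
  if x.1 = y.1 ∧ y.2.1 = x.2.1 + 1 then 1 else 0

theorem matrix_eq : J.matrix = Matrix.diagonal (fun x => J.lam x.1.1) + J.nilpart := by
  ext x y
  by_cases h : x = y
  · subst h
    simp [matrix, nilpart]
  · simp [matrix, nilpart, h]

/-- Either order of multiplication yields the next power of the nilpotent block, so the reverse
product has the same entries. -/
theorem nilpart_mul_shift (z x y : J.Idx) : (J.nilpart * J.shift z) x y =
    if x.1 = z.1 ∧ y.1 = z.1 ∧ y.2.1 = x.2.1 + z.2.1 + 1 then 1 else 0 := by
  rw [Matrix.mul_apply]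
  split_ifs with h
  · obtain ⟨hx, hy, hxy⟩ := h
    -- The only contributing middle index follows `x` in its block; it exists because `y` lies in
    -- that block at or beyond it.
    have hb : x.2.1 + 1 < J.n x.1 := by
      have := y.2.2
      have e : J.n y.1 = J.n x.1 := by rw [hx, hy]
      omega
    rw [Finset.sum_eq_single (⟨x.1, ⟨x.2.1 + 1, hb⟩⟩ : J.Idx)]
    · rw [nilpart, shift, if_pos ⟨rfl, rfl⟩, if_pos ⟨hx, hy, by simp only; omega⟩, one_mul]
    · intro w _ hw
      rw [nilpart, if_neg, zero_mul]
      rintro ⟨h1, h2⟩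
      exact hw (J.idx_ext h1.symm h2)
    · simp
  · refine Finset.sum_eq_zero fun w _ => ?_
    by_cases h1 : x.1 = w.1 ∧ w.2.1 = x.2.1 + 1
    · rw [shift, if_neg, mul_zero]
      rintro ⟨h2, h3, h4⟩
      exact h ⟨h1.1.trans h2, h3, by omega⟩
    · rw [nilpart, if_neg h1, zero_mul]

theorem shift_mul_nilpart (z x y : J.Idx) : (J.shift z * J.nilpart) x y =
    if x.1 = z.1 ∧ y.1 = z.1 ∧ y.2.1 = x.2.1 + z.2.1 + 1 then 1 else 0 := by
  rw [Matrix.mul_apply]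
  split_ifs with h
  · obtain ⟨hx, hy, hxy⟩ := h
    have hb : x.2.1 + z.2.1 < J.n y.1 := by
      have := y.2.2
      omega
    rw [Finset.sum_eq_single (⟨y.1, ⟨x.2.1 + z.2.1, hb⟩⟩ : J.Idx)]
    · rw [nilpart, shift, if_pos ⟨hx, hy, rfl⟩, if_pos ⟨rfl, hxy⟩, one_mul]
    · intro w _ hw
      rw [shift]
      split_ifs with h1
      · exact absurd (J.idx_ext (y := ⟨y.1, ⟨x.2.1 + z.2.1, hb⟩⟩) (h1.2.1.trans hy.symm) h1.2.2) hw
      · rw [zero_mul]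
    · simp
  · refine Finset.sum_eq_zero fun w _ => ?_
    by_cases h1 : w.1 = y.1 ∧ y.2.1 = w.2.1 + 1
    · rw [shift, if_neg, zero_mul]
      rintro ⟨h2, h3, h4⟩
      exact h ⟨h2, h1.1.symm.trans h3, by omega⟩
    · rw [nilpart, if_neg h1, mul_zero]

theorem commMap_shift (z : J.Idx) : commMap J.matrix (J.shift z) = 0 := by
  have h1 : J.nilpart * J.shift z = J.shift z * J.nilpart := by
    ext x y
    rw [nilpart_mul_shift, shift_mul_nilpart]
  have h2 : Matrix.diagonal (fun x : J.Idx => J.lam x.1.1) * J.shift z =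
      J.shift z * Matrix.diagonal (fun x : J.Idx => J.lam x.1.1) := by
    ext x y
    rw [Matrix.diagonal_mul, Matrix.mul_diagonal, shift]
    split_ifs with h
    · rw [h.1, h.2.1, mul_one, one_mul]
    · simp
  simp only [commMap, LinearMap.sub_apply, LinearMap.mulLeft_apply, LinearMap.mulRight_apply]
  rw [matrix_eq, add_mul, mul_add, h1, h2, sub_self]

/-- The entry in the first row of the block of `z` and in column `z` is nonzero for `shift z` alone.
-/
theorem linearIndependent_shift : LinearIndependent ℂ J.shift := by
  rw [Fintype.linearIndependent_iff]
  intro g hg z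
  have h := congrFun (congrFun hg (J.first z.1)) z
  rw [Matrix.sum_apply, Finset.sum_eq_single z] at h
  · simpa [shift, first] using h
  · intro w _ hw
    rw [Matrix.smul_apply, shift, if_neg, smul_zero]
    rintro ⟨_, h2, h3⟩
    exact hw (J.idx_ext h2.symm (by simpa [first] using h3.symm))
  · simp

theorem card_le_finrank_ker_commMap :
    Fintype.card J.Idx ≤ Module.finrank ℂ (LinearMap.ker (commMap J.matrix)) := by
  have h : LinearIndependent ℂ
      (fun z => (⟨J.shift z, J.commMap_shift z⟩ : LinearMap.ker (commMap J.matrix))) :=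
    LinearIndependent.of_comp (LinearMap.ker (commMap J.matrix)).subtype
      J.linearIndependent_shift
  exact h.fintype_card_le_finrank

/-- The domain of a linear map transversal to the tangent space of the orbit of a Jordan matrix
has dimension at least the size of the matrix; in case of equality the map is injective. -/
theorem injective_of_range_sup_eq_top {V : Type*} [AddCommGroup V] [Module ℂ V]
    [FiniteDimensional ℂ V] (D : V →ₗ[ℂ] Matrix J.Idx J.Idx ℂ)
    (hV : Module.finrank ℂ V = Fintype.card J.Idx)
    (hD : LinearMap.range (commMap J.matrix) ⊔ LinearMap.range D = ⊤) :
    Function.Injective D := by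
  have h1 := Submodule.finrank_add_le_finrank_add_finrank
    (LinearMap.range (commMap J.matrix)) (LinearMap.range D)
  rw [hD, finrank_top] at h1
  have h2 := (commMap J.matrix).finrank_range_add_finrank_ker
  have h3 := D.finrank_range_add_finrank_ker
  have h4 := J.card_le_finrank_ker_commMap
  rw [← LinearMap.ker_eq_bot, ← Submodule.finrank_eq_zero]
  -- With `n` the matrix size, the range of the commutator map has dimension at most `n² - n`, so
  -- `D` has rank at least `n = dim V`.
  omega

end JordanData

/-! ### The delay family -/

/-- The linear map `α ↦ Σ_m α_m A_m` on coefficient vectors. -/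
def coeffMap {N δ : ℕ} (A : Fin δ → Fin N → ℂ) : (Fin δ → ℂ) →ₗ[ℂ] (Fin N → ℂ) :=
  Fintype.linearCombination ℂ A

theorem delayOp_apply {τ : ℝ} {N : ℕ} (t : Fin N → Set.Icc (-τ) (0 : ℝ)) (a : Fin N → ℂ)
    (z : Phase τ) : delayOp t a z = ∑ j, a j * z (t j) := by
  simp [delayOp]

theorem delayOp_coeffMap_apply {τ : ℝ} {N δ : ℕ} (t : Fin N → Set.Icc (-τ) (0 : ℝ))
    (A : Fin δ → Fin N → ℂ) (α : Fin δ → ℂ) (z : Phase τ) :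
    delayOp t (coeffMap A α) z = ∑ m, α m * delayOp t (A m) z := by
  simp only [delayOp_apply, coeffMap, Fintype.linearCombination_apply, Finset.sum_apply,
    Pi.smul_apply, Finset.sum_mul, Finset.mul_sum, smul_eq_mul, mul_assoc]
  exact Finset.sum_comm

theorem delayFamily_eq {τ : ℝ} {N δ : ℕ} (L₀ : Phase τ →L[ℂ] ℂ)
    (t : Fin N → Set.Icc (-τ) (0 : ℝ)) (A : Fin δ → Fin N → ℂ) (α : Fin δ → ℂ) :
    delayFamily L₀ t A α = L₀ + delayOp t (coeffMap A α) := by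
  ext z
  simp [delayFamily, delayOp_coeffMap_apply]

theorem coeffMap_injective_of_isCanonicalChoice {τ : ℝ} {N δ : ℕ} {J : JordanData}
    {Φ : J.Idx → Phase τ} {Ψ : J.Idx → PhaseStar τ} {Ω : Module.Basis (Fin δ) ℂ J.W}
    {t : Fin N → Set.Icc (-τ) (0 : ℝ)} {A : Fin δ → Fin N → ℂ}
    (h : IsCanonicalChoice J Φ Ψ Ω t A) : Function.Injective (coeffMap A) := by
  obtain ⟨E, hE, -, -, hEA⟩ := h
  rw [injective_iff_map_eq_zero]
  intro α hα
  have h1 : E (∑ m, α m • Ω m) = ∑ j, coeffMap A α j •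
      Matrix.vecMulVec (fun i => ev (Ψ i) 0) (fun i => Φ i (t j)) := by
    simp only [map_sum, map_smul, hEA, coeffMap, Fintype.linearCombination_apply,
      Finset.sum_apply, Pi.smul_apply, Finset.sum_smul, Finset.smul_sum, smul_assoc]
    exact Finset.sum_comm
  rw [hα] at h1
  have h2 : ∑ m, α m • Ω m = 0 := hE (by simpa using h1)
  exact funext (Fintype.linearIndependent_iff.1 Ω.linearIndependent α h2)

/-- The derivative at `0` of the reduced matrix of a delay family. -/
noncomputable def reducedDeriv {τ : ℝ} {ι : Type} {N δ : ℕ} (Φ : ι → Phase τ)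
    (Ψ : ι → PhaseStar τ) (t : Fin N → Set.Icc (-τ) (0 : ℝ)) (A : Fin δ → Fin N → ℂ) :
    (Fin δ → ℂ) →ₗ[ℂ] Matrix ι ι ℂ where
  toFun α := Matrix.of fun x y => ev (Ψ x) 0 * delayOp t (coeffMap A α) (Φ y)
  map_add' α β := by
    ext x y
    simp [delayOp_apply, add_mul, Finset.sum_add_distrib, mul_add]
  map_smul' a α := by
    ext x y
    simp [delayOp_apply, Finset.mul_sum, mul_assoc, mul_left_comm]

theorem reducedDeriv_apply {τ : ℝ} {ι : Type} {N δ : ℕ} (Φ : ι → Phase τ)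
    (Ψ : ι → PhaseStar τ) (t : Fin N → Set.Icc (-τ) (0 : ℝ)) (A : Fin δ → Fin N → ℂ)
    (α : Fin δ → ℂ) (x y : ι) :
    reducedDeriv Φ Ψ t A α x y = ev (Ψ x) 0 * delayOp t (coeffMap A α) (Φ y) := rfl

/-- Versality, applied to the line `B + sE` and differentiated at `s = 0`, writes an arbitrary `E`
as a commutator with `B` plus a value of the derivative of the reduced family. -/
theorem mem_range_sup_of_isLambdaVersal {τ : ℝ} {ι : Type} [Fintype ι] [DecidableEq ι] {N δ : ℕ}
    {L₀ : Phase τ →L[ℂ] ℂ} {Φ : ι → Phase τ} {Ψ : ι → PhaseStar τ} {B : Matrix ι ι ℂ}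
    {t : Fin N → Set.Icc (-τ) (0 : ℝ)} {A : Fin δ → Fin N → ℂ}
    (hver : IsLambdaVersal L₀ Φ Ψ B (delayFamily L₀ t A)) :
    LinearMap.range (commMap B) ⊔ LinearMap.range (reducedDeriv Φ Ψ t A) = ⊤ := by
  obtain ⟨-, -, h, h', hh, -, h0, -, -, hv⟩ := hver
  rw [eq_top_iff]
  rintro E -
  obtain ⟨φ, C, hφ, hC, hφ0, hC0, hev⟩ := hv 1 (fun β => B + β 0 • E) 0
    ⟨fun x y => by
      simp only [Matrix.add_apply, Matrix.smul_apply, smul_eq_mul]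
      have : AnalyticAt ℂ (fun β : Fin 1 → ℂ => β 0) 0 :=
        (ContinuousLinearMap.proj (R := ℂ) (φ := fun _ : Fin 1 => ℂ) 0).analyticAt 0
      exact analyticAt_const.add (this.mul analyticAt_const), by simp⟩
  let ℓ : ℂ → Fin 1 → ℂ := fun s _ => s
  have hℓ : HasDerivAt ℓ (fun _ => 1) 0 := hasDerivAt_pi.2 fun _ => hasDerivAt_id _
  have hℓ0 : ℓ 0 = 0 := rfl
  obtain ⟨φ', hφ'⟩ : ∃ φ' : Fin δ → ℂ, HasDerivAt (fun s => φ (ℓ s)) φ' 0 :=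
    ⟨_, (hφ.differentiableAt.hasFDerivAt.comp_hasDerivAt_of_eq (0 : ℂ) hℓ hℓ0.symm)⟩
  have hC' : ∀ x y, ∃ d : ℂ, HasDerivAt (fun s => C (ℓ s) x y) d 0 := fun x y =>
    ⟨_, ((hC x y).differentiableAt.hasFDerivAt.comp_hasDerivAt_of_eq (0 : ℂ) hℓ hℓ0.symm)⟩
  choose C' hC' using hC'
  obtain ⟨H, hH⟩ : ∃ H : ι → Phase τ, HasDerivAt (fun s => h (φ (ℓ s))) H 0 := by
    have e : (0 : Fin δ → ℂ) = φ (ℓ 0) := by rw [hℓ0, hφ0]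
    exact ⟨_, hh.differentiableAt.hasFDerivAt.comp_hasDerivAt_of_eq (0 : ℂ) hφ' e⟩
  -- The correction `h` does not contribute to first order: it vanishes at `0` and is multiplied by
  -- the parameters.
  have hR : ∀ x y, HasDerivAt
      (fun s => reducedMatrix L₀ (delayFamily L₀ t A (φ (ℓ s))) Φ Ψ B (h (φ (ℓ s))) x y)
      (reducedDeriv Φ Ψ t A φ' x y) 0 := by
    intro x y
    have e : ∀ s, reducedMatrix L₀ (delayFamily L₀ t A (φ (ℓ s))) Φ Ψ B (h (φ (ℓ s))) x y =
        B x y + ev (Ψ x) 0 *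
          ∑ m, φ (ℓ s) m * delayOp t (A m) (Φ y + h (φ (ℓ s)) y) := by
      intro s
      simp [reducedMatrix, perturb, delayFamily, Matrix.vecMulVec_apply]
    simp only [e]
    have hm : ∀ m, HasDerivAt (fun s => φ (ℓ s) m * delayOp t (A m) (Φ y + h (φ (ℓ s)) y))
        (φ' m * delayOp t (A m) (Φ y)) 0 := by
      intro m
      have d1 := hasDerivAt_pi.1 hφ' m
      have d2 : HasDerivAt (fun s => delayOp t (A m) (Φ y + h (φ (ℓ s)) y))
          (delayOp t (A m) (H y)) 0 :=
        (delayOp t (A m)).hasFDerivAt.comp_hasDerivAt (0 : ℂ)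
          ((hasDerivAt_pi.1 hH y).const_add (Φ y))
      have d3 := d1.mul d2
      refine d3.congr_deriv ?_
      simp [hℓ0, hφ0, h0]
    refine (((HasDerivAt.fun_sum fun m (_ : m ∈ Finset.univ) => hm m).const_mul
      (ev (Ψ x) 0)).const_add (B x y)).congr_deriv ?_
    simp [reducedDeriv_apply, delayOp_coeffMap_apply]
  have hR0 : reducedMatrix L₀ (delayFamily L₀ t A (φ (ℓ 0))) Φ Ψ B (h (φ (ℓ 0))) = B := by
    ext x y
    simp [reducedMatrix, perturb, delayFamily, Matrix.vecMulVec_apply, hℓ0, hφ0]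
  -- The conjugation is cleared of `C⁻¹`, so that only products need differentiating.
  have hevs : ∀ᶠ s in 𝓝 (0 : ℂ), (B + s • E) * C (ℓ s) = C (ℓ s) *
      reducedMatrix L₀ (delayFamily L₀ t A (φ (ℓ s))) Φ Ψ B (h (φ (ℓ s))) := by
    filter_upwards [hℓ.continuousAt.eventually (hℓ0.symm ▸ hev)] with s hs
    have hdet := (Matrix.isUnit_iff_isUnit_det _).1 hs.1
    rw [show B + s • E = _ from hs.2, Matrix.mul_assoc, Matrix.nonsing_inv_mul _ hdet,
      Matrix.mul_one]
  have hmain : E + B * Matrix.of C' = Matrix.of C' * B + reducedDeriv Φ Ψ t A φ' := by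
    ext x y
    have d1 : HasDerivAt (fun s => ((B + s • E) * C (ℓ s)) x y)
        ((E + B * Matrix.of C') x y) 0 := by
      have := HasDerivAt.fun_sum fun z (_ : z ∈ Finset.univ) =>
        (((hasDerivAt_id (0 : ℂ)).mul_const (E x z)).const_add (B x z)).mul (hC' z y)
      simp only [Matrix.mul_apply, Matrix.add_apply, Matrix.smul_apply, smul_eq_mul]
      refine this.congr_deriv ?_
      simp [hℓ0, hC0, Finset.sum_add_distrib, Matrix.one_apply]
    have d2 : HasDerivAt (fun s => (C (ℓ s) *
        reducedMatrix L₀ (delayFamily L₀ t A (φ (ℓ s))) Φ Ψ B (h (φ (ℓ s)))) x y)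
        ((Matrix.of C' * B + reducedDeriv Φ Ψ t A φ') x y) 0 := by
      have := HasDerivAt.fun_sum fun z (_ : z ∈ Finset.univ) => (hC' x z).mul (hR z y)
      simp only [Matrix.mul_apply, Matrix.add_apply]
      refine this.congr_deriv ?_
      rw [hR0]
      simp [hℓ0, hC0, Finset.sum_add_distrib, Matrix.one_apply]
    exact (d1.congr_of_eventuallyEq
      (hevs.mono fun s hs => (congrFun (congrFun hs x) y).symm)).unique d2
  -- The differentiated identity reads `E = [B, -C'] + D φ'`, with `D` the map `reducedDeriv`.
  refine Submodule.mem_sup.2 ⟨commMap B (-Matrix.of C'), ⟨_, rfl⟩, _, ⟨φ', rfl⟩, ?_⟩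
  simp only [commMap, LinearMap.sub_apply, LinearMap.mulLeft_apply, LinearMap.mulRight_apply]
  rw [mul_neg, neg_mul, sub_neg_eq_add, add_assoc, ← hmain]
  abel

theorem coeffMap_injective_of_reducedDeriv_injective {τ : ℝ} {ι : Type} {N δ : ℕ}
    {Φ : ι → Phase τ} {Ψ : ι → PhaseStar τ}
    {t : Fin N → Set.Icc (-τ) (0 : ℝ)} {A : Fin δ → Fin N → ℂ}
    (h : Function.Injective (reducedDeriv Φ Ψ t A)) : Function.Injective (coeffMap A) := by
  intro α β hαβ
  refine h ?_
  ext x y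
  rw [reducedDeriv_apply, reducedDeriv_apply, hαβ]

/-! ### Structure of the generalized eigenspace -/

theorem nontrivial_P {τ : ℝ} {L₀ : Phase τ →L[ℂ] ℂ} {Λ : Set ℂ} (hne : Λ.Nonempty)
    (hΛ : ∀ lam ∈ Λ, IsEigenvalue (IsGen L₀) lam) : Nontrivial (P L₀ Λ) := by
  obtain ⟨lam, hlam⟩ := hne
  obtain ⟨φ, hφ, hgen⟩ := hΛ lam hlam
  refine (Submodule.nontrivial_iff_ne_bot).2 fun hbot => hφ ?_
  rw [← Submodule.mem_bot ℂ, ← hbot]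
  exact Submodule.subset_span ⟨lam, hlam, 1, lam • φ, hgen, sub_self _⟩

/-- With ones above the diagonal, the first column of a block has only its diagonal entry, so the
first basis function of the block is an eigenfunction. -/
theorem isDeriv_first {τ : ℝ} {J : JordanData} {Φ : J.Idx → Phase τ}
    (hB : ∀ y, IsDeriv (Φ y) (∑ x, J.matrix x y • Φ x))
    (b : Σ j : Fin J.r, Fin (J.k j)) :
    IsDeriv (Φ (J.first b)) (J.lam b.1 • Φ (J.first b)) := by
  have h := hB (J.first b)
  have hsum : ∑ x, J.matrix x (J.first b) • Φ x = J.lam b.1 • Φ (J.first b) := by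
    rw [Finset.sum_eq_single (J.first b)]
    · rw [J.matrix_first, if_pos rfl]
    · intro x _ hx
      rw [J.matrix_first, if_neg hx]
      exact zero_smul ℂ (Φ x)
    · simp
  rwa [hsum] at h

theorem ev_first_ne_zero {τ : ℝ} (hτ : 0 < τ) {J : JordanData} {Φ : J.Idx → Phase τ}
    (hB : ∀ y, IsDeriv (Φ y) (∑ x, J.matrix x y • Φ x)) (hΦ : LinearIndependent ℂ Φ)
    (b : Σ j : Fin J.r, Fin (J.k j)) : ev (Φ (J.first b)) 0 ≠ 0 := fun h =>
  hΦ.ne_zero _ (eq_zero_of_isDeriv_of_ev_zero hτ (isDeriv_first hB b) h)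

/-- Two blocks with one eigenvalue would start with two proportional eigenfunctions, against linear
independence of `Φ`. -/
theorem block_eq_of_eigenvalue_eq {τ : ℝ} (hτ : 0 < τ) {J : JordanData} {Φ : J.Idx → Phase τ}
    (hB : ∀ y, IsDeriv (Φ y) (∑ x, J.matrix x y • Φ x)) (hΦ : LinearIndependent ℂ Φ)
    (b b' : Σ j : Fin J.r, Fin (J.k j)) (hbb : b.1 = b'.1) : b = b' := by
  by_contra hne
  have h1 := isDeriv_first hB b
  rw [hbb] at h1
  have h2 := smul_eq_smul_of_isDeriv hτ h1 (isDeriv_first hB b')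
  have hne' : J.first b ≠ J.first b' := fun h => hne (congrArg Sigma.fst h)
  have h3 := (LinearIndepOn.pair_iff Φ hne').1 (hΦ.linearIndepOn _)
    (ev (Φ (J.first b')) 0) (-ev (Φ (J.first b)) 0) (by rw [h2, neg_smul, add_neg_cancel])
  exact ev_first_ne_zero hτ hB hΦ b' h3.1

theorem linearIndependent_coe_basis {ι M : Type*} [AddCommGroup M] [Module ℂ M]
    {S : Submodule ℂ M} (b : Module.Basis ι ℂ S) : LinearIndependent ℂ (fun x => (b x : M)) :=
  b.linearIndependent.map' S.subtype (Submodule.ker_subtype S)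

theorem rank_row_eq_one {ι : Type} [Fintype ι] {v : ι → ℂ} {i : ι} (hv : v i ≠ 0) :
    (Matrix.of fun (_ : Fin 1) (x : ι) => v x).rank = 1 := by
  classical
  refine le_antisymm ((Matrix.rank_le_card_height _).trans_eq (Fintype.card_fin 1)) (Nat.one_le_iff_ne_zero.2 fun h => hv ?_)
  rw [Matrix.rank, Submodule.finrank_eq_zero, LinearMap.range_eq_bot] at h
  simpa using congrFun (LinearMap.congr_fun h (Pi.single i 1)) 0

end RFDE

theorem mainTheorem5
    (τ : ℝ) (hτ : 0 < τ)
    (L₀ : RFDE.Phase τ →L[ℂ] ℂ)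
    -- a nonempty finite set of eigenvalues of the generator
    (Λ : Set ℂ) (hΛfin : Λ.Finite) (hΛne : Λ.Nonempty)
    (hΛ : ∀ lam ∈ Λ, RFDE.IsEigenvalue (RFDE.IsGen L₀) lam)
    (c : ℕ) (hc : c = Module.finrank ℂ (RFDE.P L₀ Λ))
    -- dual bases of the generalized eigenspaces, with `Φ' = Φ B` and `B` in Jordan form
    (J : RFDE.JordanData)
    (Φ : Module.Basis J.Idx ℂ (RFDE.P L₀ Λ))
    (Ψ : Module.Basis J.Idx ℂ (RFDE.PStar L₀ Λ))
    (hdual : ∀ x y, RFDE.pairing L₀ (Ψ x : RFDE.PhaseStar τ) (Φ y : RFDE.Phase τ) =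
      if x = y then 1 else 0)
    (hB : ∀ y, RFDE.IsDeriv (Φ y : RFDE.Phase τ)
      (∑ x, J.matrix x y • (Φ x : RFDE.Phase τ)))
    -- `q = rank Φ(0)` and the delay times
    (q : ℕ)
    (hq : q = (Matrix.of fun (_ : Fin 1) (x : J.Idx) =>
      RFDE.ev (Φ x : RFDE.Phase τ) 0).rank)
    (t : Fin (c - q + 1) → Set.Icc (-τ) (0 : ℝ))
    (ht : (Matrix.of fun (j : Fin (c - q + 1)) (x : J.Idx) =>
      (Φ x : RFDE.Phase τ) (t j)).rank = c)
    -- the family `L(α) = L₀ + Σ_m α_m L_m`, `L_m(z) = Σ_j A^m_j z(t_j)`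
    (δ : ℕ) (Ω : Module.Basis (Fin δ) ℂ J.W)
    (A : Fin δ → Fin (c - q + 1) → ℂ)
    (hA : RFDE.IsCanonicalChoice J (fun x => (Φ x : RFDE.Phase τ))
          (fun x => (Ψ x : RFDE.PhaseStar τ)) Ω t A ∨
        RFDE.IsLambdaVersal L₀ (fun x => (Φ x : RFDE.Phase τ))
          (fun x => (Ψ x : RFDE.PhaseStar τ)) J.matrix (RFDE.delayFamily L₀ t A)) :
    q = 1 ∧ δ = c ∧
      ∃ β : (Fin δ → ℂ) ≃ₗ[ℂ] (Fin (c - q + 1) → ℂ),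
        ∀ α : Fin δ → ℂ,
          RFDE.delayFamily L₀ t A α = L₀ + RFDE.delayOp t (β α) := by
  have hΦ : LinearIndependent ℂ (fun x => (Φ x : RFDE.Phase τ)) :=
    RFDE.linearIndependent_coe_basis Φ
  have hnt := RFDE.nontrivial_P hΛne hΛ
  obtain ⟨x₀⟩ := Φ.index_nonempty
  have hcard : c = Fintype.card J.Idx := hc.trans (Module.finrank_eq_card_basis Φ)
  have hpos : 0 < c := hcard ▸ Fintype.card_pos_iff.2 ⟨x₀⟩
  have hq1 : q = 1 :=
    hq.trans (RFDE.rank_row_eq_one (RFDE.ev_first_ne_zero hτ hB hΦ x₀.1))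
  have hW := J.finrank_W_of_block_injective (RFDE.block_eq_of_eigenvalue_eq hτ hB hΦ)
  have hδ : δ = c := by
    rw [hcard, ← hW, Module.finrank_eq_card_basis Ω, Fintype.card_fin]
  have hinj : Function.Injective (RFDE.coeffMap A) := by
    rcases hA with h | h
    · exact RFDE.coeffMap_injective_of_isCanonicalChoice h
    · exact RFDE.coeffMap_injective_of_reducedDeriv_injective
        (J.injective_of_range_sup_eq_top _ (by rw [Module.finrank_fin_fun, hδ, hcard])
          (RFDE.mem_range_sup_of_isLambdaVersal h))
  refine ⟨hq1, hδ, LinearMap.linearEquivOfInjective (RFDE.coeffMap A) hinj ?_, fun α => ?_⟩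
  · rw [Module.finrank_fin_fun, Module.finrank_fin_fun]
    -- Positivity of `c` matters here: with truncated subtraction, `c - 1 + 1 = c` fails for `c =
    -- 0`.
    omega
  · exact RFDE.delayFamily_eq L₀ t A α
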